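/- Let $d\ge 2$. For $N\subset\mathbb R^d$, $x\in N$ and $t>0$ put $$\beta_N(x,t)=\inf_L\ \sup_{z\in N\cap B(x,t)}\frac{\operatorname{dist}(z,L)}{t},$$ where $B(x,t)$ is the Euclidean ball with center $x$ and radius $t$ and the infimum is taken over all lines $L$ in $\mathbb R^d$. There is a constant $c>0$, depending only on $d$, such that for every set $N\subset\mathbb R^d$ and every real number $\beta_0$ the following holds: if $$\liminf_{r\to 0^+}\ \frac{\int_r^1\beta_N^2(x,t)\,\frac{dt}{t}}{-\log r}\ \le\ \beta_0^2\qquad\text{for all }x\in N,$$ then the Hausdorff dimension of $N$ satisfies $$\dim_H N\le 1+c\,\beta_0^2 .$$ -/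

import Mathlib

open scoped ENNReal Topology

noncomputable section

/-- The number `β_K(x, r) = inf_L sup_{z ∈ K ∩ B(x, r)} dist(z, L) / r`, the infimum being over all
lines `L` (one-dimensional affine subspaces) of `ℝ^d`. It takes values in `[0, ∞]`, so that no
infimum, supremum or distance has a default value; it is at most `1` when `0 < r` and `1 ≤ d`. -/
def betaNumber {d : ℕ} (K : Set (EuclideanSpace ℝ (Fin d))) (x : EuclideanSpace ℝ (Fin d))
    (r : ℝ) : ℝ≥0∞ :=
  ⨅ (L : AffineSubspace ℝ (EuclideanSpace ℝ (Fin d))) (_ : Module.finrank ℝ L.direction = 1),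
    ⨆ z ∈ K ∩ Metric.ball x r, Metric.infEDist z (L : Set (EuclideanSpace ℝ (Fin d))) /
      ENNReal.ofReal r

/-- The integral `∫_r^1 β_K(x, t)² dt/t`. -/
def betaSqIntegral {d : ℕ} (K : Set (EuclideanSpace ℝ (Fin d))) (x : EuclideanSpace ℝ (Fin d))
    (r : ℝ) : ℝ≥0∞ :=
  ∫⁻ t in Set.Ioc r 1, betaNumber K x t ^ 2 / ENNReal.ofReal t

end

/-! The square function is a budget that pays for branching. A piece of diameter `ℓ` lying within
`2δℓ` of a line splits into two pieces of diameter `ℓ/2 * √(1 + 64δ²)`, so up to the factor `exp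
(32δ²)` it is covered as economically as a segment. A piece that is not flat is cut into boundedly
many pieces, but then `β` is large at a whole range of scales around every point of it. Either
excess is paid for by the integral over `(3ℓ, 4ℓ]`, and the ranges used at successive steps are
disjoint; hence `exists_coveredBy_of_setLIntegral_betaNumber_le`. The liminf hypothesis puts each
point in infinitely many dyadic sublevel sets of the square function, and
`dimH_le_of_frequently_mem`, a Borel–Cantelli argument, turns the covering counts into a dimension
bound. -/

/-- `CoveredBy E r B`: the set `E` is covered by at most `B` sets of diameter at most `r`. -/
def CoveredBy {X : Type*} [PseudoMetricSpace X] (E : Set X) (r B : ℝ) : Prop :=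
  ∃ F : Finset (Set X), (F.card : ℝ) ≤ B ∧ E ⊆ ⋃ S ∈ F, S ∧
    ∀ S ∈ F, ∀ x ∈ S, ∀ y ∈ S, dist x y ≤ r

theorem CoveredBy.mono {X : Type*} [PseudoMetricSpace X] {E : Set X} {r B B' : ℝ}
    (h : CoveredBy E r B) (hB : B ≤ B') : CoveredBy E r B' := by
  obtain ⟨F, h1, h2, h3⟩ := h
  exact ⟨F, h1.trans hB, h2, h3⟩

theorem CoveredBy.empty {X : Type*} [PseudoMetricSpace X] {r B : ℝ} (hB : 0 ≤ B) :
    CoveredBy (∅ : Set X) r B :=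
  ⟨∅, by simpa using hB, by simp, by simp⟩

theorem CoveredBy.self {X : Type*} [PseudoMetricSpace X] {E : Set X} {r B : ℝ} (hB : 1 ≤ B)
    (h : ∀ x ∈ E, ∀ y ∈ E, dist x y ≤ r) : CoveredBy E r B :=
  ⟨{E}, by simpa using hB, by simp, by simpa using h⟩

theorem CoveredBy.biUnion {X ι : Type*} [PseudoMetricSpace X] (T : Finset ι) (A : ι → Set X)
    {E : Set X} {r B : ℝ} (hE : E ⊆ ⋃ i ∈ T, A i) (h : ∀ i ∈ T, CoveredBy (A i) r B) :
    CoveredBy E r (T.card * B) := by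
  classical
  choose! F h1 h2 h3 using h
  refine ⟨T.biUnion F, ?_, ?_, ?_⟩
  · calc ((T.biUnion F).card : ℝ) ≤ ((∑ i ∈ T, (F i).card : ℕ) : ℝ) := by
          exact_mod_cast Finset.card_biUnion_le
      _ = ∑ i ∈ T, ((F i).card : ℝ) := by push_cast; rfl
      _ ≤ ∑ i ∈ T, B := Finset.sum_le_sum h1
      _ = T.card * B := by simp
  · intro x hx
    obtain ⟨i, hi, hxi⟩ := Set.mem_iUnion₂.1 (hE hx)
    obtain ⟨S, hS, hxS⟩ := Set.mem_iUnion₂.1 (h2 i hi hxi)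
    exact Set.mem_iUnion₂.2 ⟨S, Finset.mem_biUnion.2 ⟨i, hi, hS⟩, hxS⟩
  · intro S hS
    obtain ⟨i, hi, hSi⟩ := Finset.mem_biUnion.1 hS
    exact h3 i hi S hSi

theorem CoveredBy.union {X : Type*} [PseudoMetricSpace X] {E E₁ E₂ : Set X} {r B : ℝ}
    (hE : E ⊆ E₁ ∪ E₂) (h₁ : CoveredBy E₁ r B) (h₂ : CoveredBy E₂ r B) :
    CoveredBy E r (2 * B) := by
  have := CoveredBy.biUnion (E := E) (r := r) (B := B) (Finset.univ : Finset Bool)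
    (fun b => if b then E₁ else E₂) (by
      intro x hx
      rcases hE hx with h | h
      · exact Set.mem_iUnion₂.2 ⟨true, by simp, by simpa using h⟩
      · exact Set.mem_iUnion₂.2 ⟨false, by simp, by simpa using h⟩) (by simp [h₁, h₂])
  simpa using this

/-! ### Geometry of splitting a set. -/

section InnerProduct

variable {V : Type*} [NormedAddCommGroup V] [InnerProductSpace ℝ V]

theorem norm_sq_eq_inner_sq_add {v : V} (hv : ‖v‖ = 1) (w : V) :
    ‖w‖ ^ 2 = (inner ℝ v w) ^ 2 + ‖w - (inner ℝ v w : ℝ) • v‖ ^ 2 := by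
  rw [norm_sub_sq_real, norm_smul, inner_smul_right, real_inner_comm, hv, mul_one,
    Real.norm_eq_abs, sq_abs]
  ring

/-- A set of diameter at most `ℓ` whose points are within `2 * δ * ℓ` of a line is the union of two
sets of diameter at most `ℓ / 2 * √(1 + 64 * δ ^ 2)`: cut it half way along the line. -/
theorem exists_halves_of_near_line {E : Set V} {ℓ δ : ℝ} (hℓ : 0 ≤ ℓ)
    (hE : ∀ x ∈ E, ∀ y ∈ E, dist x y ≤ ℓ) {L : AffineSubspace ℝ V}
    (hL : Module.finrank ℝ L.direction = 1)
    (hd : ∀ z ∈ E, ∃ y ∈ L, dist z y ≤ 2 * δ * ℓ) :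
    ∃ E₁ E₂ : Set V, E = E₁ ∪ E₂ ∧
      (∀ x ∈ E₁, ∀ y ∈ E₁, dist x y ≤ ℓ / 2 * √(1 + 64 * δ ^ 2)) ∧
      (∀ x ∈ E₂, ∀ y ∈ E₂, dist x y ≤ ℓ / 2 * √(1 + 64 * δ ^ 2)) := by
  obtain rfl | ⟨x₀, hx₀⟩ := E.eq_empty_or_nonempty
  · exact ⟨∅, ∅, by simp, by simp, by simp⟩
  obtain ⟨⟨u, hu⟩, hu0, hspan⟩ := finrank_eq_one_iff'.1 hL
  have hu0' : u ≠ 0 := fun h => hu0 (by simpa using h)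
  set v : V := (‖u‖⁻¹ : ℝ) • u with hv
  have hv1 : ‖v‖ = 1 := by
    rw [hv, norm_smul, norm_inv, norm_norm, inv_mul_cancel₀ (norm_ne_zero_iff.2 hu0')]
  have hpar : ∀ y ∈ L, ∀ y' ∈ L, ∃ c : ℝ, y - y' = c • v := by
    intro y hy y' hy'
    obtain ⟨c, hc⟩ := hspan ⟨y -ᵥ y', AffineSubspace.vsub_mem_direction hy hy'⟩
    refine ⟨c * ‖u‖, ?_⟩
    have : c • u = y - y' := by simpa using congrArg Subtype.val hc
    rw [hv, smul_smul, mul_assoc, mul_inv_cancel₀ (norm_ne_zero_iff.2 hu0'), mul_one, this]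
  have hperp : ∀ x ∈ E, ∀ y ∈ E, ‖(x - y) - (inner ℝ v (x - y) : ℝ) • v‖ ≤ 4 * δ * ℓ := by
    intro x hx y hy
    obtain ⟨x', hx', hxx⟩ := hd x hx
    obtain ⟨y', hy', hyy⟩ := hd y hy
    obtain ⟨c, hc⟩ := hpar x' hx' y' hy'
    set w := (x - x') - (y - y') with hw
    have hxy : x - y = w + c • v := by rw [hw, ← hc]; abel
    have e1 : (x - y) - (inner ℝ v (x - y) : ℝ) • v = w - (inner ℝ v w : ℝ) • v := by
      rw [hxy, inner_add_right, inner_smul_right, real_inner_self_eq_norm_sq, hv1]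
      module
    have e2 : ‖w - (inner ℝ v w : ℝ) • v‖ ≤ ‖w‖ := by
      refine le_of_sq_le_sq ?_ (norm_nonneg _)
      rw [norm_sq_eq_inner_sq_add hv1 w]
      nlinarith [sq_nonneg (inner ℝ v w : ℝ)]
    rw [e1]
    refine e2.trans ((norm_sub_le _ _).trans ?_)
    rw [← dist_eq_norm, ← dist_eq_norm]
    linarith
  set f : V → ℝ := fun z => inner ℝ v z with hf
  have hfd : ∀ x ∈ E, ∀ y ∈ E, f x - f y ≤ ℓ := by
    intro x hx y hy
    calc f x - f y = inner ℝ v (x - y) := by rw [hf, inner_sub_right]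
      _ ≤ ‖v‖ * ‖x - y‖ := real_inner_le_norm _ _
      _ ≤ ℓ := by rw [hv1, one_mul, ← dist_eq_norm]; exact hE x hx y hy
  have hbdd : BddBelow (f '' E) :=
    ⟨f x₀ - ℓ, by rintro _ ⟨y, hy, rfl⟩; linarith [hfd x₀ hx₀ y hy]⟩
  set A := sInf (f '' E)
  have hA : ∀ x ∈ E, A ≤ f x := fun x hx => csInf_le hbdd ⟨x, hx, rfl⟩
  have hA' : ∀ x ∈ E, f x ≤ A + ℓ := by
    intro x hx
    have : f x - ℓ ≤ A := le_csInf ⟨_, x₀, hx₀, rfl⟩ (by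
      rintro _ ⟨y, hy, rfl⟩; linarith [hfd x hx y hy])
    linarith
  -- Pythagoras: `(ℓ/2)² + (4δℓ)² = (ℓ/2)² * (1 + 64δ²)`.
  have key : ∀ x ∈ E, ∀ y ∈ E, |f x - f y| ≤ ℓ / 2 → dist x y ≤ ℓ / 2 * √(1 + 64 * δ ^ 2) := by
    intro x hx y hy hxy
    refine le_of_sq_le_sq ?_ (by positivity)
    rw [dist_eq_norm, norm_sq_eq_inner_sq_add hv1, mul_pow, Real.sq_sqrt (by positivity)]
    have h1 : (inner ℝ v (x - y) : ℝ) = f x - f y := by rw [hf, inner_sub_right]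
    have h2 := pow_le_pow_left₀ (norm_nonneg _) (hperp x hx y hy) 2
    have h3 := pow_le_pow_left₀ (abs_nonneg _) hxy 2
    rw [sq_abs] at h3
    rw [h1] at h2 ⊢
    nlinarith
  refine ⟨{z ∈ E | f z ≤ A + ℓ / 2}, {z ∈ E | A + ℓ / 2 ≤ f z}, ?_, ?_, ?_⟩
  · ext z
    constructor
    · intro hz
      rcases le_total (f z) (A + ℓ / 2) with h | h
      · exact Or.inl ⟨hz, h⟩
      · exact Or.inr ⟨hz, h⟩
    · rintro (h | h) <;> exact h.1
  · rintro x ⟨hx, hx'⟩ y ⟨hy, hy'⟩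
    exact key x hx y hy (abs_le.2 ⟨by linarith [hA x hx], by linarith [hA y hy]⟩)
  · rintro x ⟨hx, hx'⟩ y ⟨hy, hy'⟩
    exact key x hx y hy (abs_le.2 ⟨by linarith [hA' y hy], by linarith [hA' x hx]⟩)

/-- In a finite-dimensional space, every set is covered by boundedly many sets of half its
diameter. -/
theorem exists_cover_by_half_diam [FiniteDimensional ℝ V] :
    ∃ T : Finset V, ∀ (E : Set V) (x₀ : V) (ℓ : ℝ), 0 < ℓ → (∀ x ∈ E, dist x x₀ ≤ ℓ) →
      E ⊆ ⋃ y ∈ T, {z ∈ E | dist z (x₀ + ℓ • y) ≤ ℓ / 4} := by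
  obtain ⟨t, -, htfin, ht⟩ := (isCompact_closedBall (0 : V) 1).finite_cover_balls
    (show (0 : ℝ) < 1 / 4 by norm_num)
  refine ⟨htfin.toFinset, fun E x₀ ℓ hℓ hE x hx => ?_⟩
  have hmem : (ℓ⁻¹ : ℝ) • (x - x₀) ∈ Metric.closedBall (0 : V) 1 := by
    rw [mem_closedBall_zero_iff, norm_smul, norm_inv, Real.norm_of_nonneg hℓ.le, ← dist_eq_norm,
      inv_mul_le_iff₀ hℓ, mul_one]
    exact hE x hx
  obtain ⟨y, hy, hxy⟩ := Set.mem_iUnion₂.1 (ht hmem)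
  refine Set.mem_iUnion₂.2 ⟨y, by simpa using hy, hx, ?_⟩
  have e : x - (x₀ + ℓ • y) = ℓ • ((ℓ⁻¹ : ℝ) • (x - x₀) - y) := by
    rw [smul_sub, smul_inv_smul₀ hℓ.ne']; abel
  rw [Metric.mem_ball, dist_eq_norm] at hxy
  rw [dist_eq_norm, e, norm_smul, Real.norm_of_nonneg hℓ.le]
  nlinarith

end InnerProduct

/-! ### Comparing `β`-numbers across centres and scales. -/

variable {d : ℕ}

/-- `B(x₀, 2ℓ) ⊆ B(x, 3ℓ) ⊆ B(x, t)`, and the change of normalisation costs `t / (2ℓ) ≤ 2`. -/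
theorem betaNumber_le_two_mul_betaNumber {N : Set (EuclideanSpace ℝ (Fin d))}
    {x x₀ : EuclideanSpace ℝ (Fin d)} {ℓ t : ℝ} (hℓ : 0 < ℓ) (hx : dist x₀ x ≤ ℓ)
    (ht : 3 * ℓ ≤ t) (ht' : t ≤ 4 * ℓ) :
    betaNumber N x₀ (2 * ℓ) ≤ 2 * betaNumber N x t := by
  have hmul : ∀ a : ℝ≥0∞, a / ENNReal.ofReal (2 * ℓ) ≤ 2 * (a / ENNReal.ofReal t) := by
    intro a
    have h2 : ENNReal.ofReal t ≤ 2 * ENNReal.ofReal (2 * ℓ) := by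
      rw [show (2 : ℝ≥0∞) = ENNReal.ofReal 2 by simp, ← ENNReal.ofReal_mul (by norm_num)]
      exact ENNReal.ofReal_le_ofReal (by linarith)
    have h0 : ENNReal.ofReal (2 * ℓ) ≠ 0 := by simpa using hℓ
    rw [ENNReal.div_le_iff h0 ENNReal.ofReal_ne_top]
    have ht0 : ENNReal.ofReal t ≠ 0 := by simpa using (by linarith : 0 < t)
    calc a = a / ENNReal.ofReal t * ENNReal.ofReal t :=
          (ENNReal.div_mul_cancel ht0 ENNReal.ofReal_ne_top).symm
      _ ≤ a / ENNReal.ofReal t * (2 * ENNReal.ofReal (2 * ℓ)) := by gcongr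
      _ = _ := by ring
  rw [betaNumber, betaNumber, ENNReal.mul_iInf_of_ne two_ne_zero ENNReal.ofNat_ne_top]
  refine iInf_mono fun L => ?_
  rw [ENNReal.mul_iInf_of_ne two_ne_zero ENNReal.ofNat_ne_top]
  refine iInf_mono fun _ => iSup₂_le fun z hz => ?_
  refine (hmul _).trans ?_
  gcongr
  refine le_iSup₂_of_le z ⟨hz.1, ?_⟩ le_rfl
  have := hz.2
  rw [Metric.mem_ball] at this ⊢
  linarith [dist_triangle z x₀ x]

/-- One bad ball around `x₀` consumes budget at every nearby `x` at once: the integrand is at least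
`(q/2)² / (4ℓ)` on an interval of length `ℓ`. -/
theorem ofReal_sq_le_setLIntegral_betaNumber {N : Set (EuclideanSpace ℝ (Fin d))}
    {x x₀ : EuclideanSpace ℝ (Fin d)} {ℓ q : ℝ} (hℓ : 0 < ℓ) (hx : dist x₀ x ≤ ℓ) (hq : 0 ≤ q)
    (hβ : ENNReal.ofReal q ≤ betaNumber N x₀ (2 * ℓ)) :
    ENNReal.ofReal (q ^ 2 / 16) ≤
      ∫⁻ t in Set.Ioc (3 * ℓ) (4 * ℓ), betaNumber N x t ^ 2 / ENNReal.ofReal t := by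
  have hpt : ∀ t ∈ Set.Ioc (3 * ℓ) (4 * ℓ),
      ENNReal.ofReal (q ^ 2 / (16 * ℓ)) ≤ betaNumber N x t ^ 2 / ENNReal.ofReal t := by
    rintro t ⟨ht, ht'⟩
    have h1 : ENNReal.ofReal (q / 2) ≤ betaNumber N x t := by
      have := hβ.trans (betaNumber_le_two_mul_betaNumber hℓ hx ht.le ht')
      rw [ENNReal.ofReal_div_of_pos two_pos]
      exact ENNReal.div_le_of_le_mul' (by simpa using this)
    have ht0 : 0 < t := by linarith
    calc ENNReal.ofReal (q ^ 2 / (16 * ℓ)) ≤ ENNReal.ofReal ((q / 2) ^ 2 / t) := by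
          apply ENNReal.ofReal_le_ofReal
          rw [div_pow, div_div]
          apply div_le_div_of_nonneg_left (sq_nonneg q) (by positivity)
          linarith
      _ = ENNReal.ofReal (q / 2) ^ 2 / ENNReal.ofReal t := by
          rw [ENNReal.ofReal_div_of_pos ht0, ENNReal.ofReal_pow (by positivity)]
      _ ≤ _ := by gcongr
  calc ENNReal.ofReal (q ^ 2 / 16)
      = ∫⁻ _ in Set.Ioc (3 * ℓ) (4 * ℓ), ENNReal.ofReal (q ^ 2 / (16 * ℓ)) := by
        rw [MeasureTheory.setLIntegral_const, Real.volume_Ioc, ← ENNReal.ofReal_mul (by positivity)]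
        congr 1
        field_simp
        ring
    _ ≤ _ := MeasureTheory.setLIntegral_mono' measurableSet_Ioc hpt

theorem exists_line_of_betaNumber_lt {N E : Set (EuclideanSpace ℝ (Fin d))}
    {x₀ : EuclideanSpace ℝ (Fin d)} {ℓ δ : ℝ} (hℓ : 0 < ℓ) (hEN : E ⊆ N)
    (hE : ∀ x ∈ E, dist x x₀ ≤ ℓ) (hδ : betaNumber N x₀ (2 * ℓ) < ENNReal.ofReal δ) :
    ∃ L : AffineSubspace ℝ (EuclideanSpace ℝ (Fin d)), Module.finrank ℝ L.direction = 1 ∧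
      ∀ z ∈ E, ∃ y ∈ L, dist z y ≤ 2 * δ * ℓ := by
  -- The infimum over lines need not be attained, hence the strict inequality in `hδ`.
  rw [betaNumber] at hδ
  simp only [iInf_lt_iff] at hδ
  obtain ⟨L, hL, hlt⟩ := hδ
  refine ⟨L, hL, fun z hz => ?_⟩
  have h0 : ENNReal.ofReal (2 * ℓ) ≠ 0 := by simpa using hℓ
  have h1 : Metric.infEDist z (L : Set (EuclideanSpace ℝ (Fin d))) / ENNReal.ofReal (2 * ℓ)
      < ENNReal.ofReal δ := by
    refine lt_of_le_of_lt ?_ hlt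
    refine le_iSup₂_of_le (f := fun z (_ : z ∈ N ∩ Metric.ball x₀ (2 * ℓ)) =>
      Metric.infEDist z (L : Set (EuclideanSpace ℝ (Fin d))) / ENNReal.ofReal (2 * ℓ))
      z ⟨hEN hz, ?_⟩ le_rfl
    rw [Metric.mem_ball]
    linarith [hE z hz]
  have hδ0 : 0 < δ := ENNReal.ofReal_pos.1 (pos_of_gt h1)
  rw [ENNReal.div_lt_iff (Or.inl h0) (Or.inl ENNReal.ofReal_ne_top),
    ← ENNReal.ofReal_mul hδ0.le, Metric.infEDist_lt_iff] at h1
  obtain ⟨y, hy, hzy⟩ := h1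
  refine ⟨y, hy, ?_⟩
  rw [edist_dist, ENNReal.ofReal_lt_ofReal_iff (by positivity)] at hzy
  linarith

/-- If the integral over `(b, c]` is at least `q`, the integral over the rest of `(a, c]` is at most
the total minus `q`. -/
theorem setLIntegral_Ioc_le_sub {g : ℝ → ℝ≥0∞} {a b b' c M q : ℝ}
    (hab : a ≤ b) (hb' : b' ≤ b) (hbc : b ≤ c) (hq : 0 ≤ q)
    (hM : ∫⁻ t in Set.Ioc a c, g t ≤ ENNReal.ofReal M)
    (hgain : ENNReal.ofReal q ≤ ∫⁻ t in Set.Ioc b c, g t) :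
    ∫⁻ t in Set.Ioc a b', g t ≤ ENNReal.ofReal (M - q) := by
  have h1 : ∫⁻ t in Set.Ioc a c, g t =
      (∫⁻ t in Set.Ioc a b, g t) + ∫⁻ t in Set.Ioc b c, g t := by
    rw [← MeasureTheory.lintegral_union measurableSet_Ioc, Set.Ioc_union_Ioc_eq_Ioc hab hbc]
    exact Set.disjoint_left.2 fun t ht ht' => absurd ht.2 (not_le.2 ht'.1)
  have h2 : ∫⁻ t in Set.Ioc a b', g t ≤ ∫⁻ t in Set.Ioc a b, g t :=
    MeasureTheory.lintegral_mono_set (Set.Ioc_subset_Ioc_right hb')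
  rw [ENNReal.ofReal_sub _ hq]
  refine ENNReal.le_sub_of_add_le_right ENNReal.ofReal_ne_top ?_
  calc _ ≤ (∫⁻ t in Set.Ioc a b, g t) + ∫⁻ t in Set.Ioc b c, g t := add_le_add h2 hgain
    _ ≤ _ := h1 ▸ hM

/-! ### Counting pieces by induction on scale. -/

/-- A set on which the square function of the `β`-numbers between the scales `r` and `ℓ` is bounded
by `M` can be covered by about `ℓ / r * exp (Λ * M)` sets of diameter `r`. -/
theorem exists_coveredBy_of_setLIntegral_betaNumber_le (d : ℕ) :
    ∃ Λ : ℝ, 0 < Λ ∧ ∀ (N : Set (EuclideanSpace ℝ (Fin d))) (r ε : ℝ), 0 < r → 0 < ε →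
      ∀ (k : ℕ) (E : Set (EuclideanSpace ℝ (Fin d))) (ℓ M : ℝ), E ⊆ N → r / 2 ≤ ℓ →
        ℓ ≤ r * (4 / 3) ^ k → 0 ≤ M → (∀ x ∈ E, ∀ y ∈ E, dist x y ≤ ℓ) →
        (∀ x ∈ E, ∫⁻ t in Set.Ioc (3 * r) (4 * ℓ), betaNumber N x t ^ 2 / ENNReal.ofReal t
          ≤ ENNReal.ofReal M) →
        CoveredBy E r (2 * (ℓ / r) * Real.exp (Λ * M + k * ε)) := by
  obtain ⟨T, hT⟩ := exists_cover_by_half_diam (V := EuclideanSpace ℝ (Fin d))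
  -- A step with `β = q` lowers `M` by `q²/16`: `512/16 = 32` pays for `exp (32q²)` in the flat
  -- case, and `1024 * (1/8)²/16 = 1` pays for the `T.card` pieces otherwise.
  refine ⟨512 + 1024 * T.card, by positivity, fun N r ε hr hε k => ?_⟩
  set Λ : ℝ := 512 + 1024 * T.card with hΛ
  have hΛ0 : 0 < Λ := by positivity
  have base : ∀ (k : ℕ) (E : Set (EuclideanSpace ℝ (Fin d))) (ℓ M : ℝ), r / 2 ≤ ℓ → ℓ ≤ r →
      0 ≤ M → (∀ x ∈ E, ∀ y ∈ E, dist x y ≤ ℓ) →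
      CoveredBy E r (2 * (ℓ / r) * Real.exp (Λ * M + k * ε)) := by
    intro k E ℓ M h1 h2 hM hE
    refine CoveredBy.self ?_ fun x hx y hy => (hE x hx y hy).trans h2
    have : 1 ≤ 2 * (ℓ / r) := by rw [← mul_div_assoc, le_div_iff₀ hr]; linarith
    exact one_le_mul_of_one_le_of_one_le this (Real.one_le_exp (by positivity))
  induction k with
  | zero =>
    intro E ℓ M _ h1 h2 hM hE _
    exact base 0 E ℓ M h1 (by simpa using h2) hM hE
  | succ k ih =>
    intro E ℓ M hEN h1 h2 hM hE hint
    rcases le_or_gt ℓ r with hℓr | hℓr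
    · exact base (k + 1) E ℓ M h1 hℓr hM hE
    have hℓ : 0 < ℓ := hr.trans hℓr
    obtain rfl | ⟨x₀, hx₀⟩ := E.eq_empty_or_nonempty
    · exact CoveredBy.empty (by positivity)
    have hE₀ : ∀ x ∈ E, dist x x₀ ≤ ℓ := fun x hx => hE x hx x₀ hx₀
    -- New diameters are at most `3ℓ/4`, so later integrals stop at `3ℓ`, below the range just
    -- spent.
    have gain : ∀ (q : ℝ), 0 ≤ q → ENNReal.ofReal q ≤ betaNumber N x₀ (2 * ℓ) →
        q ^ 2 / 16 ≤ M ∧ ∀ ℓ' : ℝ, ℓ' ≤ 3 / 4 * ℓ → ∀ x ∈ E,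
          ∫⁻ t in Set.Ioc (3 * r) (4 * ℓ'), betaNumber N x t ^ 2 / ENNReal.ofReal t
            ≤ ENNReal.ofReal (M - q ^ 2 / 16) := by
      intro q hq hqβ
      have hg : ∀ x ∈ E, _ := fun x hx => ofReal_sq_le_setLIntegral_betaNumber (x := x) hℓ
        (hE x₀ hx₀ x hx) hq hqβ
      refine ⟨?_, fun ℓ' hℓ' x hx => setLIntegral_Ioc_le_sub (b := 3 * ℓ) (c := 4 * ℓ)
        (by linarith) (by linarith) (by linarith) (by positivity) (hint x hx) (hg x hx)⟩
      rw [← ENNReal.ofReal_le_ofReal_iff hM]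
      exact (hg x₀ hx₀).trans ((MeasureTheory.lintegral_mono_set
        (Set.Ioc_subset_Ioc_left (by linarith))).trans (hint x₀ hx₀))
    rw [pow_succ] at h2
    have hℓk : 3 / 4 * ℓ ≤ r * (4 / 3) ^ k := by linarith
    rcases lt_or_ge (betaNumber N x₀ (2 * ℓ)) (ENNReal.ofReal (1 / 8)) with hβ | hβ
    · set q := (betaNumber N x₀ (2 * ℓ)).toReal with hq
      have hqβ : ENNReal.ofReal q = betaNumber N x₀ (2 * ℓ) := ENNReal.ofReal_toReal hβ.ne_top
      have hq0 : 0 ≤ q := ENNReal.toReal_nonneg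
      rw [← hqβ, ENNReal.ofReal_lt_ofReal_iff (by norm_num)] at hβ
      -- The slack `ε/32` in `δ²` becomes one `ε` in the exponent, matching the passage from `k` to
      -- `k + 1`.
      obtain ⟨δ, hqδ, hδ⟩ := exists_between (lt_min hβ
        (Real.lt_sqrt_of_sq_lt (lt_add_of_pos_right (q ^ 2) (show 0 < ε / 32 by positivity))))
      have hδ8 : δ < 1 / 8 := hδ.trans_le (min_le_left _ _)
      have hδ0 : 0 < δ := hq0.trans_lt hqδ
      have hδε : δ ^ 2 ≤ q ^ 2 + ε / 32 :=
        (Real.le_sqrt' hδ0).1 (hδ.trans_le (min_le_right _ _)).le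
      obtain ⟨hqM, hgain⟩ := gain q hq0 hqβ.le
      obtain ⟨L, hL, hLE⟩ := exists_line_of_betaNumber_lt hℓ hEN hE₀
        (by rwa [← hqβ, ENNReal.ofReal_lt_ofReal_iff hδ0])
      obtain ⟨E₁, E₂, rfl, hd₁, hd₂⟩ := exists_halves_of_near_line hℓ.le hE hL hLE
      set ℓ' := ℓ / 2 * √(1 + 64 * δ ^ 2) with hℓ'
      have hs1 : 1 ≤ √(1 + 64 * δ ^ 2) := Real.one_le_sqrt.2 (by nlinarith [sq_nonneg δ])
      have hs2 : √(1 + 64 * δ ^ 2) ≤ 3 / 2 := by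
        rw [Real.sqrt_le_left (by norm_num)]
        nlinarith
      have hs3 : √(1 + 64 * δ ^ 2) ≤ Real.exp (32 * δ ^ 2) := by
        rw [Real.sqrt_le_left (Real.exp_pos _).le, ← Real.exp_nat_mul]
        have := Real.add_one_le_exp (64 * δ ^ 2)
        have e : ((2 : ℕ) : ℝ) * (32 * δ ^ 2) = 64 * δ ^ 2 := by push_cast; ring
        rw [e]
        linarith
      have hlow : r / 2 ≤ ℓ' := by nlinarith
      have hup : ℓ' ≤ 3 / 4 * ℓ := by nlinarith
      have hsub : ∀ E' ⊆ E₁ ∪ E₂, (∀ x ∈ E', ∀ y ∈ E', dist x y ≤ ℓ') →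
          CoveredBy E' r (2 * (ℓ' / r) * Real.exp (Λ * (M - q ^ 2 / 16) + k * ε)) :=
        fun E' hE' hd => ih E' ℓ' _ (hE'.trans hEN) hlow (hup.trans hℓk) (by linarith) hd
          fun x hx => hgain ℓ' hup x (hE' hx)
      refine (CoveredBy.union subset_rfl (hsub E₁ Set.subset_union_left hd₁)
        (hsub E₂ Set.subset_union_right hd₂)).mono ?_
      calc 2 * (2 * (ℓ' / r) * Real.exp (Λ * (M - q ^ 2 / 16) + k * ε))
          = 2 * (ℓ / r) * (√(1 + 64 * δ ^ 2) * Real.exp (Λ * (M - q ^ 2 / 16) + k * ε)) := by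
            rw [hℓ']; ring
        _ ≤ 2 * (ℓ / r) * (Real.exp (32 * δ ^ 2) *
              Real.exp (Λ * (M - q ^ 2 / 16) + k * ε)) := by gcongr
        _ ≤ _ := by
            rw [← Real.exp_add]
            refine mul_le_mul_of_nonneg_left (Real.exp_le_exp.2 ?_) (by positivity)
            have : 512 * q ^ 2 ≤ Λ * q ^ 2 := by
              gcongr
              rw [hΛ]
              linarith [show (0 : ℝ) ≤ 1024 * T.card by positivity]
            push_cast
            linarith
    · obtain ⟨hqM, hgain⟩ := gain (1 / 8) (by norm_num) hβ
      have hsub := CoveredBy.biUnion T _ (hT E x₀ ℓ hℓ hE₀) (r := r)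
        (B := 2 * (ℓ / 2 / r) * Real.exp (Λ * (M - (1 / 8) ^ 2 / 16) + k * ε)) (by
          intro y _
          refine ih _ (ℓ / 2) _ ((Set.sep_subset _ _).trans hEN) (by linarith)
            (le_trans (by linarith) hℓk) (by linarith) ?_
            fun x hx => hgain _ (by linarith) x hx.1
          rintro x ⟨_, hx⟩ z ⟨_, hz⟩
          linarith [dist_triangle_right x z (x₀ + ℓ • y)])
      refine hsub.mono ?_
      calc T.card * (2 * (ℓ / 2 / r) * Real.exp (Λ * (M - (1 / 8) ^ 2 / 16) + k * ε))
          ≤ Real.exp T.card *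
            (2 * (ℓ / r) * Real.exp (Λ * (M - (1 / 8) ^ 2 / 16) + k * ε)) := by
            gcongr
            · linarith [Real.add_one_le_exp (T.card : ℝ)]
            · linarith
        _ = 2 * (ℓ / r) * Real.exp (T.card + (Λ * (M - (1 / 8) ^ 2 / 16) + k * ε)) := by
            rw [Real.exp_add (T.card : ℝ)]; ring
        _ ≤ _ := by
            refine mul_le_mul_of_nonneg_left (Real.exp_le_exp.2 ?_) (by positivity)
            push_cast
            linarith

/-! ### From covering counts to Hausdorff dimension. -/

open MeasureTheory in
/-- If every point of `A` lies in infinitely many of the sets `E n`, and `E n` is covered by `B n`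
sets of diameter `2⁻ⁿ` with `∑ B n * 2 ^ (-n * s)` finite, then `A` has dimension at most `s`. -/
theorem dimH_le_of_frequently_mem {X : Type*} [MetricSpace X] {A : Set X} {E : ℕ → Set X}
    {B : ℕ → ℝ} {s : ℝ} (hs : 0 < s) (hA : ∀ x ∈ A, ∃ᶠ n in Filter.atTop, x ∈ E n)
    (hE : ∀ n, CoveredBy (E n) ((1 / 2) ^ n) (B n))
    (hB : Summable fun n => B n * ((1 / 2 : ℝ) ^ n) ^ s) : dimH A ≤ ENNReal.ofReal s := by
  borelize X
  choose F hcard hcov hdiam using hE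
  have hed : ∀ n, ∀ S ∈ F n, Metric.ediam S ≤ ENNReal.ofReal ((1 / 2) ^ n) := by
    intro n S hS
    refine Metric.ediam_le fun x hx y hy => ?_
    rw [edist_dist]
    exact ENNReal.ofReal_le_ofReal (hdiam n S hS x hx y hy)
  classical
  -- The levels `n ≥ m` still cover `A`; padding the others with `∅` keeps the index type
  -- independent of `m`.
  let t : ℕ → (Σ n : ℕ, F n) → Set X := fun m p => if m ≤ p.1 then (p.2 : Set X) else ∅
  have hmain : μH[s] A ≤ Filter.liminf (fun m => ∑' p, Metric.ediam (t m p) ^ s)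
      Filter.atTop := by
    refine Measure.hausdorffMeasure_le_liminf_tsum s A
      (fun m : ℕ => ENNReal.ofReal ((1 / 2) ^ m)) ?_ t ?_ ?_
    · have := ENNReal.tendsto_ofReal (tendsto_pow_atTop_nhds_zero_of_lt_one
        (show (0 : ℝ) ≤ 1 / 2 by norm_num) (by norm_num))
      simpa using this
    · refine Filter.Eventually.of_forall fun m p => ?_
      by_cases h : m ≤ p.1
      · simp only [t, if_pos h]
        refine (hed p.1 p.2 p.2.2).trans (ENNReal.ofReal_le_ofReal ?_)
        exact pow_le_pow_of_le_one (by norm_num) (by norm_num) h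
      · simp [t, if_neg h]
    · refine Filter.Eventually.of_forall fun m x hx => ?_
      obtain ⟨n, hn, hxn⟩ := (Filter.frequently_atTop.1 (hA x hx)) m
      obtain ⟨S, hS, hxS⟩ := Set.mem_iUnion₂.1 (hcov n hxn)
      refine Set.mem_iUnion.2 ⟨⟨n, S, hS⟩, ?_⟩
      simpa [t, hn] using hxS
  have hbound : ∀ m, ∑' p, Metric.ediam (t m p) ^ s ≤
      ∑' n, ENNReal.ofReal (B n * ((1 / 2 : ℝ) ^ n) ^ s) := by
    intro m
    rw [ENNReal.tsum_sigma']
    refine ENNReal.tsum_le_tsum fun n => ?_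
    rw [tsum_fintype]
    calc ∑ S : F n, Metric.ediam (t m ⟨n, S⟩) ^ s
        ≤ ∑ _S : F n, ENNReal.ofReal (((1 / 2 : ℝ) ^ n) ^ s) := by
          refine Finset.sum_le_sum fun S _ => ?_
          rw [← ENNReal.ofReal_rpow_of_nonneg (by positivity) hs.le]
          refine ENNReal.rpow_le_rpow ?_ hs.le
          by_cases h : m ≤ n
          · simpa [t, h] using hed n S S.2
          · simp [t, h]
      _ = ENNReal.ofReal ((F n).card * ((1 / 2 : ℝ) ^ n) ^ s) := by
          rw [Finset.sum_const, nsmul_eq_mul, ENNReal.ofReal_mul (by positivity)]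
          simp
      _ ≤ _ := by
          apply ENNReal.ofReal_le_ofReal
          gcongr
          exact hcard n
  have hfin : μH[s] A ≠ ⊤ := by
    refine ne_top_of_le_ne_top hB.tsum_ofReal_ne_top (hmain.trans ?_)
    refine (Filter.liminf_le_liminf (Filter.Eventually.of_forall hbound)).trans ?_
    simp
  exact dimH_le_of_hausdorffMeasure_ne_top (d := s.toNNReal)
    (by rwa [Real.coe_toNNReal _ hs.le])

/-- Round `r` up to a dyadic scale: the integral decreases, and `-log r ≤ (n + 1) * log 2 ≤ n + 1`.
-/
theorem frequently_betaSqIntegral_le {N : Set (EuclideanSpace ℝ (Fin d))}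
    {x : EuclideanSpace ℝ (Fin d)} {b ε : ℝ} (hb : 0 ≤ b) (hε : 0 < ε)
    (h : Filter.liminf (fun r : ℝ => betaSqIntegral N x r / ENNReal.ofReal (-Real.log r))
      (𝓝[>] (0 : ℝ)) ≤ ENNReal.ofReal b) :
    ∃ᶠ n : ℕ in Filter.atTop,
      betaSqIntegral N x ((1 / 2) ^ n) ≤ ENNReal.ofReal ((b + ε) * (n + 1)) := by
  have hlt : Filter.liminf (fun r : ℝ => betaSqIntegral N x r / ENNReal.ofReal (-Real.log r))
      (𝓝[>] (0 : ℝ)) < ENNReal.ofReal (b + ε) :=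
    h.trans_lt ((ENNReal.ofReal_lt_ofReal_iff (by linarith)).2 (by linarith))
  have hfreq := Filter.frequently_lt_of_liminf_lt (by isBoundedDefault) hlt
  rw [Filter.frequently_atTop]
  intro m
  have hev : ∀ᶠ r : ℝ in 𝓝[>] (0 : ℝ), r ∈ Set.Ioo (0 : ℝ) ((1 / 2) ^ m) :=
    Ioo_mem_nhdsGT (by positivity)
  obtain ⟨r, hr, hr0, hrm⟩ := (hfreq.and_eventually hev).exists
  have hr1 : r < 1 := hrm.trans_le (pow_le_one₀ (by norm_num) (by norm_num))
  obtain ⟨n, hn1, hn2⟩ := exists_nat_pow_near_of_lt_one hr0 hr1.le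
    (show (0 : ℝ) < 1 / 2 by norm_num) (by norm_num)
  refine ⟨n, ?_, ?_⟩
  · by_contra hnm
    have : ((1 : ℝ) / 2) ^ m ≤ (1 / 2) ^ (n + 1) :=
      pow_le_pow_of_le_one (by norm_num) (by norm_num) (by omega)
    linarith
  · have hlog : -Real.log r ≤ n + 1 := by
      have h1 : Real.log ((1 / 2) ^ (n + 1)) ≤ Real.log r := Real.log_le_log (by positivity) hn1.le
      rw [Real.log_pow, one_div, Real.log_inv] at h1
      push_cast at h1
      have h2 := Real.log_two_lt_d9
      have h3 : ((n : ℝ) + 1) * Real.log 2 ≤ (n + 1) * 1 := by gcongr; linarith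
      linarith
    have hlog0 : 0 < -Real.log r := by linarith [Real.log_neg hr0 hr1]
    have h4 : betaSqIntegral N x r ≤ ENNReal.ofReal (b + ε) * ENNReal.ofReal (-Real.log r) := by
      refine (ENNReal.div_le_iff ?_ ENNReal.ofReal_ne_top).1 hr.le
      simpa using hlog0
    calc betaSqIntegral N x ((1 / 2) ^ n) ≤ betaSqIntegral N x r :=
          MeasureTheory.lintegral_mono_set (Set.Ioc_subset_Ioc_left hn2)
      _ ≤ _ := h4
      _ ≤ _ := by
          rw [← ENNReal.ofReal_mul (by linarith)]
          exact ENNReal.ofReal_le_ofReal (by gcongr)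

theorem theorem2 (d : ℕ) (hd : 2 ≤ d) :
    ∃ c : ℝ, 0 < c ∧
      ∀ (N : Set (EuclideanSpace ℝ (Fin d))) (β₀ : ℝ),
        (∀ x ∈ N,
          Filter.liminf
            (fun r : ℝ => betaSqIntegral N x r / ENNReal.ofReal (-Real.log r))
            (𝓝[>] (0 : ℝ)) ≤ ENNReal.ofReal (β₀ ^ 2)) →
        dimH N ≤ ENNReal.ofReal (1 + c * β₀ ^ 2) := by
  obtain ⟨Λ, hΛ, hcov⟩ := exists_coveredBy_of_setLIntegral_betaNumber_le d
  refine ⟨2 * Λ, by positivity, fun N β₀ hN => ?_⟩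
  -- Pieces of diameter at most `ℓ = 1/4` make the upper limit `4ℓ` equal to `1`.
  have hN' : N ⊆ ⋃ j : ℕ, N ∩ Metric.ball (TopologicalSpace.denseSeq _ j) (1 / 8) := by
    intro x hx
    obtain ⟨j, hj⟩ := (TopologicalSpace.denseRange_denseSeq
      (EuclideanSpace ℝ (Fin d))).exists_dist_lt x (show (0 : ℝ) < 1 / 8 by norm_num)
    exact Set.mem_iUnion.2 ⟨j, hx, hj⟩
  refine (dimH_mono hN').trans ?_
  rw [dimH_iUnion]
  refine iSup_le fun j => ?_
  set A := N ∩ Metric.ball (TopologicalSpace.denseSeq _ j) (1 / 8) with hA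
  have hlim : Filter.Tendsto
      (fun ε : ℝ => ENNReal.ofReal (1 + 2 * (Λ * (β₀ ^ 2 + ε) + 3 * ε) + ε)) (𝓝[>] 0)
      (𝓝 (ENNReal.ofReal (1 + 2 * Λ * β₀ ^ 2))) := by
    refine ENNReal.tendsto_ofReal ?_
    have : Continuous fun ε : ℝ => 1 + 2 * (Λ * (β₀ ^ 2 + ε) + 3 * ε) + ε := by fun_prop
    have h0 := (this.tendsto 0).mono_left (nhdsWithin_le_nhds (s := Set.Ioi 0))
    simpa [mul_assoc] using h0
  refine ge_of_tendsto hlim ?_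
  filter_upwards [self_mem_nhdsWithin] with ε hε
  rw [Set.mem_Ioi] at hε
  set b := β₀ ^ 2 + ε with hb
  have hb0 : 0 < b := by positivity
  set s := 1 + 2 * (Λ * b + 3 * ε) + ε with hs
  set B : ℕ → ℝ := fun n => 2 * (1 / 4 / ((1 / 2) ^ n / 3)) *
    Real.exp (Λ * (b * (n + 1)) + (3 * n : ℕ) * ε) with hBdef
  refine dimH_le_of_frequently_mem (E := fun n => {x ∈ A | betaSqIntegral N x ((1 / 2) ^ n) ≤
    ENNReal.ofReal (b * (n + 1))}) (B := B) (by positivity) (fun x hx => ?_) (fun n => ?_) ?_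
  · refine (frequently_betaSqIntegral_le (sq_nonneg β₀) hε (hN x hx.1)).mono ?_
    exact fun n hn => ⟨hx, hn⟩
  · have hp : (0 : ℝ) < (1 / 2) ^ n := by positivity
    have hp1 : ((1 : ℝ) / 2) ^ n ≤ 1 := pow_le_one₀ (by norm_num) (by norm_num)
    -- The radius makes the lower limit `3r` equal to `(1/2)^n`; `3 * n` steps suffice because
    -- `(4/3)³ ≥ 2`.
    have hc := hcov N ((1 / 2) ^ n / 3) ε (by positivity) hε (3 * n)
      {x ∈ A | betaSqIntegral N x ((1 / 2) ^ n) ≤ ENNReal.ofReal (b * (n + 1))} (1 / 4)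
      (b * (n + 1)) (fun x hx => hx.1.1) (by linarith) ?_ (by positivity) ?_ ?_
    · obtain ⟨F, h1, h2, h3⟩ := hc
      exact ⟨F, h1, h2, fun S hS x hx y hy => (h3 S hS x hx y hy).trans (by linarith)⟩
    · have : (1 : ℝ) ≤ (1 / 2) ^ n * (4 / 3) ^ (3 * n) := by
        rw [pow_mul, ← mul_pow]
        exact one_le_pow₀ (by norm_num)
      linarith
    · rintro x ⟨⟨_, hx⟩, _⟩ y ⟨⟨_, hy⟩, _⟩
      rw [Metric.mem_ball] at hx hy
      linarith [dist_triangle_right x y (TopologicalSpace.denseSeq _ j)]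
    · rintro x ⟨_, hx⟩
      rw [betaSqIntegral] at hx
      convert hx using 4 <;> ring
  · have hterm : ∀ n : ℕ, B n * ((1 / 2 : ℝ) ^ n) ^ s =
        3 / 2 * Real.exp (Λ * b) *
          Real.exp (Λ * b + 3 * ε - (s - 1) * Real.log 2) ^ n := by
      intro n
      have e1 : ((1 / 2 : ℝ) ^ n) = Real.exp (-(n * Real.log 2)) := by
        rw [← mul_neg, Real.exp_nat_mul, Real.exp_neg, Real.exp_log two_pos, one_div]
      have e2 : ((1 / 2 : ℝ) ^ n) ^ s = Real.exp (-(n * Real.log 2) * s) := by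
        rw [e1, ← Real.exp_mul]
      have e3 : 2 * (1 / 4 / (((1 : ℝ) / 2) ^ n / 3)) = 3 / 2 * Real.exp (n * Real.log 2) := by
        rw [e1, Real.exp_neg]
        field_simp
        norm_num
      rw [hBdef]
      simp only
      rw [e3, e2, ← Real.exp_nat_mul, mul_assoc, mul_assoc, mul_assoc, ← Real.exp_add,
        ← Real.exp_add, ← Real.exp_add]
      congr 2
      push_cast
      ring
    simp_rw [hterm]
    refine (summable_geometric_of_lt_one (Real.exp_pos _).le ?_).mul_left _
    rw [Real.exp_lt_one_iff]
    have hlog := Real.log_two_gt_d9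
    -- `log 2 > 1/2` is the origin of the factor `2` in `c = 2Λ`.
    have h1 : (s - 1) * (1 / 2) < (s - 1) * Real.log 2 := by
      apply mul_lt_mul_of_pos_left (by linarith)
      have : 0 < 2 * (Λ * b + 3 * ε) := by positivity
      linarith
    linarith
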